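/- An \emph{MV-algebra} is a set $A$ with a binary operation $\oplus$, a unary operation $*$ and a constant $0$ such that $(A,\oplus,0)$ is a commutative monoid and, for all $x,y\in A$, $x^{**}=x$, $x\oplus 0^{*}=0^{*}$ and $(x^{*}\oplus y)^{*}\oplus y=(y^{*}\oplus x)^{*}\oplus x$. Put $x\odot y=(x^{*}\oplus y^{*})^{*}$. The \emph{zero-divisor graph} $\Gamma(A)$ is the simple graph whose vertices are the elements $x\neq 0$ of $A$ for which there is $y\neq 0$ in $A$ with $x\odot y=0$, two distinct vertices $x,y$ being adjacent if and only if $x\odot y=0$. The girth $\operatorname{gr}(\Gamma)$ of a graph $\Gamma$ is the length of a shortest cycle of $\Gamma$, and $\infty$ if $\Gamma$ has no cycles. For $n\geq 2$ let $L_n=\{0,\frac1{n-1},\dots,\frac{n-2}{n-1},1\}$ with $x\oplus y=\min\{1,x+y\}$ and $x^{*}=1-x$, let $B_4$ be the four-element Boolean algebra, regarded as an MV-algebra with $\oplus$ the join, $*$ the complement and $0$ the least element, and let products of MV-algebras carry the componentwise operations. \textbf{Theorem.} Let $A$ be an MV-algebra (finite or infinite) with $|A|\geq 3$. Then $$\operatorname{gr}(\Gamma(A))=\begin{cases}\infty,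 & \text{if } A\cong L_3,\ A\cong L_4,\ A\cong L_5,\ A\cong B_4 \text{ or } A\cong L_2\times L_3;\\ 3, & \text{otherwise,}\end{cases}$$ where $\cong$ denotes isomorphism of MV-algebras. -/

import Mathlib

universe u v

/-- An MV-algebra `(A, ⊕, *, 0)`: `(A, ⊕, 0)` is a commutative monoid, `x** = x`,
`x ⊕ 0* = 0*` and `(x* ⊕ y)* ⊕ y = (y* ⊕ x)* ⊕ x`. -/
class MVAlgebra (A : Type u) where
  oplus : A → A → A
  star : A → A
  zero : A
  oplus_assoc : ∀ x y z : A, oplus (oplus x y) z = oplus x (oplus y z)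
  oplus_comm : ∀ x y : A, oplus x y = oplus y x
  oplus_zero : ∀ x : A, oplus x zero = x
  star_star : ∀ x : A, star (star x) = x
  oplus_star_zero : ∀ x : A, oplus x (star zero) = star zero
  oplus_star_oplus : ∀ x y : A,
    oplus (star (oplus (star x) y)) y = oplus (star (oplus (star y) x)) x

namespace MVAlgebra

/-- The product `x ⊙ y = (x* ⊕ y*)*`. -/
def odot {A : Type u} [MVAlgebra A] (x y : A) : A :=
  star (oplus (star x) (star y))

theorem odot_comm {A : Type u} [MVAlgebra A] (x y : A) : odot x y = odot y x := by
  simp only [odot, oplus_comm]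

/-- Isomorphisms of MV-algebras. -/
structure Iso (A : Type u) (B : Type v) [MVAlgebra A] [MVAlgebra B] extends A ≃ B where
  map_oplus : ∀ x y : A, toFun (oplus x y) = oplus (toFun x) (toFun y)
  map_star : ∀ x : A, toFun (star x) = star (toFun x)
  map_zero : toFun zero = zero

/-- Two MV-algebras are isomorphic. -/
def Isomorphic (A : Type u) (B : Type v) [MVAlgebra A] [MVAlgebra B] : Prop :=
  Nonempty (Iso A B)

/-- The direct product of two MV-algebras, with componentwise operations. -/
instance instProd (A : Type u) (B : Type v) [MVAlgebra A] [MVAlgebra B] :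
    MVAlgebra (A × B) where
  oplus p q := (oplus p.1 q.1, oplus p.2 q.2)
  star p := (star p.1, star p.2)
  zero := (zero, zero)
  oplus_assoc _ _ _ := Prod.ext (oplus_assoc _ _ _) (oplus_assoc _ _ _)
  oplus_comm _ _ := Prod.ext (oplus_comm _ _) (oplus_comm _ _)
  oplus_zero _ := Prod.ext (oplus_zero _) (oplus_zero _)
  star_star _ := Prod.ext (star_star _) (star_star _)
  oplus_star_zero _ := Prod.ext (oplus_star_zero _) (oplus_star_zero _)
  oplus_star_oplus _ _ := Prod.ext (oplus_star_oplus _ _) (oplus_star_oplus _ _)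

/-- The standard MV-algebra on the real unit interval:
`x ⊕ y = min 1 (x + y)` and `x* = 1 - x`. -/
noncomputable instance instUnitInterval : MVAlgebra unitInterval where
  oplus x y := ⟨min 1 ((x : ℝ) + y),
    le_min zero_le_one (add_nonneg x.2.1 y.2.1), min_le_left _ _⟩
  star x := ⟨1 - (x : ℝ), sub_nonneg.2 x.2.2, sub_le_self _ x.2.1⟩
  zero := ⟨0, le_rfl, zero_le_one⟩
  oplus_assoc := by
    rintro ⟨x, hx⟩ ⟨y, hy⟩ ⟨z, hz⟩
    apply Subtype.ext
    have hx0 := hx.1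
    have hz0 := hz.1
    rcases le_total 1 (x + y) with h | h <;> rcases le_total 1 (y + z) with h' | h' <;>
      simp only [min_eq_left h, min_eq_right h, min_eq_left h', min_eq_right h', add_assoc] <;>
      (rw [min_eq_left, min_eq_left] <;> linarith)
  oplus_comm x y := Subtype.ext (by simp only [add_comm])
  oplus_zero x := Subtype.ext (by simpa using x.2.2)
  star_star x := Subtype.ext (by simp)
  oplus_star_zero x := Subtype.ext (by simpa using x.2.1)
  oplus_star_oplus := by
    rintro ⟨x, hx⟩ ⟨y, hy⟩
    apply Subtype.ext
    simp only
    rcases le_total x y with h | h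
    · rw [min_eq_left (a := (1 : ℝ)) (b := 1 - x + y) (by linarith),
        min_eq_right (a := (1 : ℝ)) (b := 1 - y + x) (by linarith)]
      congr 1; ring
    · rw [min_eq_right (a := (1 : ℝ)) (b := 1 - x + y) (by linarith),
        min_eq_left (a := (1 : ℝ)) (b := 1 - y + x) (by linarith)]
      congr 1; ring

/-- The finite set `L n = {0, 1/(n-1), …, (n-2)/(n-1), 1}`, meant for `n ≥ 2`. -/
def L (n : ℕ) : Set unitInterval :=
  {x | ∃ k : ℕ, k ≤ n - 1 ∧ (x : ℝ) = (k : ℝ) / ((n - 1 : ℕ) : ℝ)}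

/-- For `n ≥ 2`, the set `L n` is a subalgebra of the unit interval. -/
noncomputable instance instL (n : ℕ) [hn : n.AtLeastTwo] : MVAlgebra (L n) where
  oplus x y := ⟨oplus x.1 y.1, by
    obtain ⟨j, -, hj⟩ := x.2
    obtain ⟨k, -, hk⟩ := y.2
    have hpos : (0 : ℝ) < ((n - 1 : ℕ) : ℝ) := by
      have := hn.prop
      exact_mod_cast (by omega : 0 < n - 1)
    refine ⟨min (n - 1) (j + k), min_le_left _ _, ?_⟩
    change min 1 (((x : unitInterval) : ℝ) + ((y : unitInterval) : ℝ)) = _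
    rw [hj, hk, Nat.cast_min, ← min_div_div_right hpos.le, div_self hpos.ne', Nat.cast_add,
      add_div]⟩
  star x := ⟨star x.1, by
    obtain ⟨j, hj', hj⟩ := x.2
    have hpos : (0 : ℝ) < ((n - 1 : ℕ) : ℝ) := by
      have := hn.prop
      exact_mod_cast (by omega : 0 < n - 1)
    refine ⟨(n - 1) - j, Nat.sub_le _ _, ?_⟩
    change 1 - ((x : unitInterval) : ℝ) = _
    rw [hj, Nat.cast_sub hj', sub_div, div_self hpos.ne']⟩
  zero := ⟨zero, 0, Nat.zero_le _, by
    change (0 : ℝ) = _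
    simp⟩
  oplus_assoc _ _ _ := Subtype.ext (oplus_assoc _ _ _)
  oplus_comm _ _ := Subtype.ext (oplus_comm _ _)
  oplus_zero _ := Subtype.ext (oplus_zero _)
  star_star _ := Subtype.ext (star_star _)
  oplus_star_zero _ := Subtype.ext (oplus_star_zero _)
  oplus_star_oplus _ _ := Subtype.ext (oplus_star_oplus _ _)

/-- A Boolean algebra as an MV-algebra: `⊕` is the join, `*` the complement, `0` the bottom. -/
abbrev ofBooleanAlgebra (B : Type u) [BooleanAlgebra B] : MVAlgebra B where
  oplus x y := x ⊔ y
  star x := xᶜ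
  zero := ⊥
  oplus_assoc := sup_assoc
  oplus_comm := sup_comm
  oplus_zero := sup_bot_eq
  star_star := compl_compl
  oplus_star_zero x := by simp
  oplus_star_oplus x y := by
    simp only [compl_sup, compl_compl]
    rw [sup_inf_right, sup_inf_right, compl_sup_eq_top, compl_sup_eq_top, inf_top_eq,
      inf_top_eq, sup_comm]

/-- The four-element Boolean algebra. -/
def B4 : Type := Bool × Bool

instance : BooleanAlgebra B4 := inferInstanceAs (BooleanAlgebra (Bool × Bool))

instance instB4 : MVAlgebra B4 := ofBooleanAlgebra B4

/-- The nonzero zero-divisors of `A` with respect to `⊙`. -/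
def nonzeroZeroDivisors (A : Type u) [MVAlgebra A] : Set A :=
  {x | x ≠ zero ∧ ∃ y : A, y ≠ zero ∧ odot x y = zero}

/-- The zero-divisor graph `Γ(A)`: the vertices are the nonzero zero-divisors, and distinct
vertices `x`, `y` are adjacent iff `x ⊙ y = 0`. -/
def zeroDivisorGraph (A : Type u) [MVAlgebra A] : SimpleGraph (nonzeroZeroDivisors A) where
  Adj x y := x ≠ y ∧ odot (x : A) (y : A) = zero
  symm := ⟨fun _ _ h => ⟨h.1.symm, (odot_comm _ _).trans h.2⟩⟩
  loopless := ⟨fun _ h => h.1 rfl⟩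

end MVAlgebra

-- In the natural order, `x ⊙ y = 0` means `x ≤ y*`; call such elements orthogonal. A triangle is a
-- triple of distinct nonzero pairwise orthogonal elements, so the girth is 3 as soon as one exists.
-- The core is that, without such a triple and with an element other than 0 and 1, `A` is one of the
-- five algebras (`OrthogonalTripleFree.isomorphic`).
--
-- If `A` is a chain, the nonzero elements below their own negations are pairwise orthogonal, so
-- there are at most two; the rest of `A` is their negations, 0 and 1. All elements are then
-- multiples of the least nonzero one, giving `L 3`, `L 4` or `L 5`.
--
-- If `x` and `y` are incomparable, their two differences are nonzero and disjoint, and the absence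
-- of triples turns them into a nontrivial complemented `e`. Then `A` is the product of the
-- intervals below `e` and `e*`, each with two or three elements; two three-element factors would
-- create a triple.
--
-- Conversely, the graphs of the five algebras map injectively into a path on four vertices, hence
-- have no cycles.

universe w

namespace MVAlgebra

local notation:65 x:65 "∔" y:66 => oplus x y
local notation:70 x:70 "⊙" y:71 => odot x y
local notation:max x:max "⋆" => star x
local notation "𝟎" => zero
local notation "𝟏" => star zero

/-! ### The natural order -/

section Order

variable {A : Type u} [MVAlgebra A]

theorem zero_oplus (x : A) : 𝟎 ∔ x = x := by rw [oplus_comm, oplus_zero]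

theorem one_oplus (x : A) : 𝟏 ∔ x = 𝟏 := by rw [oplus_comm, oplus_star_zero]

theorem star_injective : Function.Injective (star : A → A) :=
  Function.LeftInverse.injective star_star

theorem star_oplus_self (x : A) : x⋆ ∔ x = 𝟏 := by
  have h := oplus_star_oplus x 𝟏
  rwa [oplus_star_zero, star_star, zero_oplus, eq_comm] at h

theorem oplus_left_comm (x y z : A) : x ∔ (y ∔ z) = y ∔ (x ∔ z) := by
  rw [← oplus_assoc, oplus_comm x y, oplus_assoc]

theorem oplus_oplus_oplus_comm (x y z w : A) : x ∔ y ∔ (z ∔ w) = x ∔ z ∔ (y ∔ w) := by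
  rw [oplus_assoc, oplus_left_comm y, ← oplus_assoc]

theorem star_odot (x y : A) : (x ⊙ y)⋆ = x⋆ ∔ y⋆ := star_star _

theorem star_oplus (x y : A) : (x ∔ y)⋆ = x⋆ ⊙ y⋆ := by
  rw [odot, star_star, star_star]

theorem odot_assoc (x y z : A) : x ⊙ y ⊙ z = x ⊙ (y ⊙ z) := by
  simp only [odot, star_star, oplus_assoc]

theorem odot_one (x : A) : x ⊙ 𝟏 = x := by
  rw [odot, star_star, oplus_zero, star_star]

theorem one_odot (x : A) : 𝟏 ⊙ x = x := by rw [odot_comm, odot_one]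

theorem odot_star_self (x : A) : x ⊙ x⋆ = 𝟎 := by
  rw [odot, oplus_comm, star_oplus_self, star_star]

theorem odot_star_oplus_comm (x y : A) : x ⊙ (x⋆ ∔ y) = y ⊙ (y⋆ ∔ x) := by
  have h := oplus_star_oplus x⋆ y⋆
  simp only [star_star] at h
  simp only [odot]
  rw [oplus_comm x⋆ y, oplus_comm y⋆ x, oplus_comm, ← h, oplus_comm]

theorem oplus_odot_star {x y : A} (h : x⋆ ∔ y = 𝟏) : x ∔ y ⊙ x⋆ = y := by
  rw [odot, star_star, oplus_comm, oplus_star_oplus, h, star_star, zero_oplus]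

/-- The witness is the difference `y ⊙ x*`. This form makes transitivity and monotonicity of `⊕`
immediate. -/
theorem star_oplus_eq_one_iff {x y : A} : x⋆ ∔ y = 𝟏 ↔ ∃ t, x ∔ t = y := by
  refine ⟨fun h => ⟨_, oplus_odot_star h⟩, ?_⟩
  rintro ⟨t, rfl⟩
  rw [← oplus_assoc, star_oplus_self, one_oplus]

/-- The natural partial order of an MV-algebra: `x ≤ y` iff `x* ⊕ y = 1`. -/
abbrev partialOrder : PartialOrder A where
  le x y := x⋆ ∔ y = 𝟏
  le_refl := star_oplus_self
  le_trans x y z hxy hyz := by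
    obtain ⟨s, rfl⟩ := star_oplus_eq_one_iff.1 hxy
    obtain ⟨t, rfl⟩ := star_oplus_eq_one_iff.1 hyz
    rw [oplus_assoc]
    exact star_oplus_eq_one_iff.2 ⟨_, rfl⟩
  le_antisymm x y hxy hyx := by
    have h := oplus_star_oplus x y
    rw [hxy, hyx, star_star, zero_oplus, zero_oplus] at h
    exact h.symm

attribute [local instance] partialOrder

theorem le_iff {x y : A} : x ≤ y ↔ x⋆ ∔ y = 𝟏 := Iff.rfl

theorem le_iff_exists {x y : A} : x ≤ y ↔ ∃ t, x ∔ t = y := star_oplus_eq_one_iff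

theorem zero_le (x : A) : 𝟎 ≤ x := le_iff_exists.2 ⟨x, zero_oplus x⟩

theorem le_one (x : A) : x ≤ 𝟏 := oplus_star_zero _

theorem le_zero_iff {x : A} : x ≤ 𝟎 ↔ x = 𝟎 :=
  ⟨fun h => le_antisymm h (zero_le x), fun h => h.le⟩

theorem star_le_star_iff {x y : A} : x⋆ ≤ y⋆ ↔ y ≤ x := by
  rw [le_iff, le_iff, star_star, oplus_comm]

theorem le_star_comm {x y : A} : x ≤ y⋆ ↔ y ≤ x⋆ := by
  rw [← star_le_star_iff, star_star]

theorem odot_eq_zero_iff {x y : A} : x ⊙ y = 𝟎 ↔ x ≤ y⋆ := by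
  rw [le_iff, odot, ← star_injective.eq_iff, star_star]

theorem odot_star_eq_zero_iff {x y : A} : x ⊙ y⋆ = 𝟎 ↔ x ≤ y := by
  rw [odot_eq_zero_iff, star_star]

theorem le_oplus_right (x y : A) : x ≤ x ∔ y := le_iff_exists.2 ⟨y, rfl⟩

theorem le_oplus_left (x y : A) : x ≤ y ∔ x := oplus_comm x y ▸ le_oplus_right x y

theorem odot_le_left (x y : A) : x ⊙ y ≤ x := by
  rw [← star_le_star_iff, star_odot]
  exact le_oplus_right _ _

theorem odot_le_right (x y : A) : x ⊙ y ≤ y := odot_comm x y ▸ odot_le_left y x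

theorem oplus_le_oplus_left {x y : A} (h : x ≤ y) (z : A) : z ∔ x ≤ z ∔ y := by
  obtain ⟨t, rfl⟩ := le_iff_exists.1 h
  exact le_iff_exists.2 ⟨t, oplus_assoc _ _ _⟩

theorem oplus_le_oplus {x y z w : A} (h : x ≤ y) (h' : z ≤ w) : x ∔ z ≤ y ∔ w := by
  refine (oplus_le_oplus_left h' x).trans ?_
  rw [oplus_comm x, oplus_comm y]
  exact oplus_le_oplus_left h w

theorem odot_le_odot_left {x y : A} (h : x ≤ y) (z : A) : z ⊙ x ≤ z ⊙ y := by
  rw [← star_le_star_iff, star_odot, star_odot]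
  exact oplus_le_oplus_left (star_le_star_iff.2 h) _

theorem oplus_odot_star_of_le {x y : A} (h : x ≤ y) : x ∔ y ⊙ x⋆ = y := oplus_odot_star h

theorem odot_star_oplus_of_le {x y : A} (h : x ≤ y) : y ⊙ (y⋆ ∔ x) = x := by
  rw [odot_star_oplus_comm, le_iff.1 h, odot_one]

/-- The natural lattice structure of an MV-algebra. -/
abbrev lattice : Lattice A where
  __ := partialOrder
  sup x y := x ∔ y ⊙ x⋆
  le_sup_left x y := le_oplus_right _ _
  le_sup_right x y := by
    have h := oplus_star_oplus x y
    rw [odot, star_star, oplus_comm, ← h]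
    exact le_oplus_left _ _
  sup_le x y z hx hy := by
    refine le_of_le_of_eq (oplus_le_oplus_left ?_ x) (oplus_odot_star_of_le hx)
    rw [odot_comm y, odot_comm z]
    exact odot_le_odot_left hy _
  inf x y := x ⊙ (x⋆ ∔ y)
  inf_le_left x y := odot_le_left _ _
  inf_le_right x y := by
    rw [odot_star_oplus_comm]
    exact odot_le_left _ _
  le_inf x y z hy hz :=
    le_of_eq_of_le (odot_star_oplus_of_le hy).symm
      (odot_le_odot_left (oplus_le_oplus_left hz _) _)

end Order

/-! ### Disjoint and complemented elements -/

section Lattice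

variable {A : Type u} [MVAlgebra A]

attribute [local instance] lattice

theorem inf_eq (x y : A) : x ⊓ y = x ⊙ (x⋆ ∔ y) := rfl

/-- Prelinearity: the two differences of two elements are disjoint. -/
theorem odot_star_inf_odot_star (x y : A) : x ⊙ y⋆ ⊓ y ⊙ x⋆ = 𝟎 := by
  have h₁ : x ⊙ y⋆ ⊓ y ⊙ x⋆ = x ⊙ (y⋆ ⊓ (x⋆ ∔ y ⊙ x⋆)) := by
    rw [inf_eq, inf_eq, star_odot, odot_assoc, star_star, oplus_comm x⋆ y, oplus_assoc]
  have h₂ : x ⊙ (y⋆ ⊓ (x⋆ ∔ y ⊙ x⋆)) =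
      x ⊙ (x⋆ ∔ y ⊙ x⋆) ⊙ ((x⋆ ∔ y ⊙ x⋆)⋆ ∔ y⋆) := by
    rw [inf_comm, inf_eq, odot_assoc]
  have h₃ : x ⊙ (x⋆ ∔ y ⊙ x⋆) ≤ y ⊙ x⋆ := inf_le_right (a := x)
  have h₄ : y ⊙ (y⋆ ∔ x ⊙ (y ⊙ x⋆)⋆) ≤ x :=
    (inf_le_right (a := y)).trans (odot_le_left _ _)
  -- Bounding `x ⊓ (y ⊙ x*)` by `y ⊙ x*` frees a factor `x*`; the other factors lie below `x` by
  -- `h₄`, so the meet is at most `x* ⊙ x = 0`.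
  rw [h₁, h₂, ← le_zero_iff, odot_comm]
  refine (odot_le_odot_left h₃ _).trans ?_
  have h₅ : ((x⋆ ∔ y ⊙ x⋆)⋆ ∔ y⋆) ⊙ (y ⊙ x⋆) =
      x⋆ ⊙ (y ⊙ (y⋆ ∔ x ⊙ (y ⊙ x⋆)⋆)) := by
    rw [star_oplus, star_star, oplus_comm, odot_comm, odot_comm x⋆, odot_assoc, odot_assoc,
      odot_comm x⋆]
  rw [h₅, ← odot_star_self x, odot_comm x x⋆]
  exact odot_le_odot_left h₄ _

theorem odot_eq_zero_of_inf_eq_zero {x y : A} (h : x ⊓ y = 𝟎) : x ⊙ y = 𝟎 :=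
  le_zero_iff.1 (h ▸ le_inf (odot_le_left _ _) (odot_le_right _ _))

theorem le_star_of_inf_eq_zero {x y : A} (h : x ⊓ y = 𝟎) : x ≤ y⋆ :=
  odot_eq_zero_iff.1 (odot_eq_zero_of_inf_eq_zero h)

/-- If `x ⊕ y = y` and `x ⊙ y = 0` then `x = 0`. -/
theorem eq_zero_of_oplus_eq_self {x y : A} (hxy : x ≤ y⋆) (h : x ∔ y = y) : x = 𝟎 := by
  have h' : y⋆ ⊓ x = 𝟎 := by
    rw [inf_eq, star_star, oplus_comm, h, odot_comm, odot_star_self]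
  rwa [inf_eq_right.2 hxy] at h'

/-- The excess of `(x ⊕ x) ⊓ y` over `x` lies below `y` and below `(x ⊕ x) ⊙ x* = x* ⊓ x`, so it
vanishes. -/
theorem inf_oplus_self_eq_zero {x y : A} (h : x ⊓ y = 𝟎) : (x ∔ x) ⊓ y = 𝟎 := by
  refine le_zero_iff.1 (h ▸ le_inf ?_ inf_le_right)
  rw [← odot_star_eq_zero_iff, ← le_zero_iff, ← h, odot_comm]
  refine le_inf ?_ ((odot_le_right _ _).trans inf_le_right)
  have h' : x⋆ ⊓ x = x⋆ ⊙ (x ∔ x) := by rw [inf_eq, star_star]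
  exact (odot_le_odot_left inf_le_left _).trans (h' ▸ inf_le_right)

/-- Since `x* ⊓ x = x* ⊙ (x ⊕ x)`, being complemented forces `x ⊕ x ≤ x`. -/
theorem oplus_self_of_inf_star_eq_zero {x : A} (h : x ⊓ x⋆ = 𝟎) : x ∔ x = x := by
  refine le_antisymm ?_ (le_oplus_right _ _)
  rw [inf_comm, inf_eq, star_star, odot_comm] at h
  exact odot_star_eq_zero_iff.1 h

theorem star_inf_star_star {x : A} (h : x ⊓ x⋆ = 𝟎) : x⋆ ⊓ x⋆⋆ = 𝟎 := by
  rw [star_star, inf_comm, h]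

theorem odot_eq_inf_of_inf_star_eq_zero {x : A} (h : x ⊓ x⋆ = 𝟎) (y : A) : x ⊙ y = x ⊓ y := by
  rw [inf_eq]
  refine le_antisymm (odot_le_odot_left (le_oplus_left _ _) _) ?_
  have hs := oplus_self_of_inf_star_eq_zero (star_inf_star_star h)
  have hx : x ⊙ x = x := star_injective (by rw [star_odot, hs])
  have h₁ : x ⊙ (x⋆ ∔ y) ≤ y := inf_le_right (a := x)
  have h₂ := odot_le_odot_left h₁ x
  rwa [← odot_assoc, hx] at h₂

/-- A complemented element splits every element into two parts. -/
theorem odot_oplus_odot_star {x : A} (h : x ⊓ x⋆ = 𝟎) (y : A) : x ⊙ y ∔ x⋆ ⊙ y = y := by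
  have h₁ : y ⊙ (x ⊙ y)⋆ = x⋆ ⊙ y := by
    rw [odot_eq_inf_of_inf_star_eq_zero (star_inf_star_star h), star_odot, oplus_comm, inf_comm,
      inf_eq]
  rw [← h₁, oplus_odot_star_of_le (odot_le_right _ _)]

end Lattice

/-! ### Isomorphisms -/

section Isomorphic

variable {A : Type u} {B : Type v} {C : Type w} [MVAlgebra A] [MVAlgebra B] [MVAlgebra C]

theorem Isomorphic.symm (h : Isomorphic A B) : Isomorphic B A := by
  obtain ⟨f⟩ := h
  refine ⟨⟨f.toEquiv.symm, fun x y => ?_, fun x => ?_, ?_⟩⟩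
  · refine f.toEquiv.symm_apply_eq.2 (Eq.symm ?_)
    refine (f.map_oplus _ _).trans ?_
    exact congrArg₂ _ (f.toEquiv.apply_symm_apply x) (f.toEquiv.apply_symm_apply y)
  · refine f.toEquiv.symm_apply_eq.2 (Eq.symm ?_)
    exact (f.map_star _).trans (congrArg _ (f.toEquiv.apply_symm_apply x))
  · exact f.toEquiv.symm_apply_eq.2 f.map_zero.symm

theorem Isomorphic.trans (h : Isomorphic A B) (h' : Isomorphic B C) : Isomorphic A C := by
  obtain ⟨f⟩ := h
  obtain ⟨g⟩ := h'
  exact ⟨⟨f.toEquiv.trans g.toEquiv,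
    fun x y => (congrArg g.toFun (f.map_oplus x y)).trans (g.map_oplus _ _),
    fun x => (congrArg g.toFun (f.map_star x)).trans (g.map_star _),
    (congrArg g.toFun f.map_zero).trans g.map_zero⟩⟩

theorem Isomorphic.prod {D : Type*} [MVAlgebra D] (h : Isomorphic A B) (h' : Isomorphic C D) :
    Isomorphic (A × C) (B × D) := by
  obtain ⟨f⟩ := h
  obtain ⟨g⟩ := h'
  exact ⟨⟨f.toEquiv.prodCongr g.toEquiv,
    fun x y => Prod.ext (f.map_oplus _ _) (g.map_oplus _ _),
    fun x => Prod.ext (f.map_star _) (g.map_star _), Prod.ext f.map_zero g.map_zero⟩⟩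

theorem isomorphic_of_bijective (f : A → B) (hf : Function.Bijective f)
    (h_oplus : ∀ x y, f (x ∔ y) = f x ∔ f y) (h_star : ∀ x, f x⋆ = (f x)⋆) (h_zero : f 𝟎 = 𝟎) :
    Isomorphic A B :=
  ⟨⟨Equiv.ofBijective f hf, h_oplus, h_star, h_zero⟩⟩

end Isomorphic

/-! ### Product decomposition along a complemented element -/

section Interval

variable {A : Type u} {B : Type v} {C : Type w} [MVAlgebra A] [MVAlgebra B] [MVAlgebra C]

attribute [local instance] lattice

/-- `f` identifies `B` with the interval `[0, e]` of `A`, with `⊕` inherited from `A` and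
`x ↦ e ⊙ x*` as negation. -/
structure IsIntervalEquiv (e : A) (f : B → A) : Prop where
  map_oplus : ∀ x y, f (x ∔ y) = f x ∔ f y
  map_star : ∀ x, f x⋆ = e ⊙ (f x)⋆
  map_zero : f 𝟎 = 𝟎
  injective : Function.Injective f
  surjective : ∀ x ≤ e, ∃ b, f b = x

theorem IsIntervalEquiv.apply_le {e : A} {f : B → A} (hf : IsIntervalEquiv e f) (x : B) :
    f x ≤ e := by
  rw [← star_star x, hf.map_star]
  exact odot_le_left _ _

theorem IsIntervalEquiv.isomorphic {f : B → A} (hf : IsIntervalEquiv 𝟏 f) : Isomorphic A B := by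
  refine (isomorphic_of_bijective f ⟨hf.injective, fun x => hf.surjective x (le_one x)⟩
    hf.map_oplus (fun x => ?_) hf.map_zero).symm
  rw [hf.map_star, one_odot]

/-- The idempotent `e*` absorbs `y`, so `e ⊓ (x ⊕ y)` reduces to `e ⊓ x`. -/
theorem odot_oplus_of_inf_star_eq_zero {e x y : A} (he : e ⊓ e⋆ = 𝟎) (hx : x ≤ e)
    (hy : y ≤ e⋆) : e ⊙ (x ∔ y) = x := by
  rw [odot_eq_inf_of_inf_star_eq_zero he, inf_eq, oplus_left_comm]
  have h : e⋆ ∔ y = e⋆ := by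
    refine le_antisymm ?_ (le_oplus_right _ _)
    refine (oplus_le_oplus_left hy _).trans (le_of_eq ?_)
    exact oplus_self_of_inf_star_eq_zero (star_inf_star_star he)
  rw [h, oplus_comm, odot_star_oplus_of_le hx]

theorem odot_star_of_le_star {e y : A} (he : e ⊓ e⋆ = 𝟎) (hy : y ≤ e⋆) : e ⊙ y⋆ = e := by
  rw [odot_eq_inf_of_inf_star_eq_zero he]
  exact inf_eq_left.2 (le_star_comm.1 hy)

/-- A complemented element decomposes an MV-algebra as a direct product. -/
theorem IsIntervalEquiv.isomorphic_prod {e : A} (he : e ⊓ e⋆ = 𝟎) {f : B → A} {g : C → A}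
    (hf : IsIntervalEquiv e f) (hg : IsIntervalEquiv e⋆ g) : Isomorphic A (B × C) := by
  have he' := star_inf_star_star he
  have hl (p : B × C) : e ⊙ (f p.1 ∔ g p.2) = f p.1 :=
    odot_oplus_of_inf_star_eq_zero he (hf.apply_le _) (hg.apply_le _)
  have hr (p : B × C) : e⋆ ⊙ (f p.1 ∔ g p.2) = g p.2 := by
    rw [oplus_comm]
    exact odot_oplus_of_inf_star_eq_zero he' (hg.apply_le _)
      ((hf.apply_le _).trans (star_star e).ge)
  refine (isomorphic_of_bijective (fun p : B × C => f p.1 ∔ g p.2) ⟨fun p q h => ?_, fun x => ?_⟩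
    (fun p q => ?_) (fun p => ?_) ?_).symm
  · have h₁ := congrArg (e ⊙ ·) h
    have h₂ := congrArg (e⋆ ⊙ ·) h
    simp only [hl, hr] at h₁ h₂
    exact Prod.ext (hf.injective h₁) (hg.injective h₂)
  · obtain ⟨b, hb⟩ := hf.surjective (e ⊙ x) (odot_le_left _ _)
    obtain ⟨c, hc⟩ := hg.surjective (e⋆ ⊙ x) (odot_le_left _ _)
    exact ⟨(b, c), by simp only [hb, hc, odot_oplus_odot_star he]⟩
  · change f (p.1 ∔ q.1) ∔ g (p.2 ∔ q.2) = _
    rw [hf.map_oplus, hg.map_oplus, oplus_oplus_oplus_comm]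
  · change f p.1⋆ ∔ g p.2⋆ = _
    -- The negation is split along `e`; in each part the negated component from the other side has
    -- no effect.
    rw [hf.map_star, hg.map_star, ← odot_oplus_odot_star he (f p.1 ∔ g p.2)⋆, star_oplus]
    congr 1
    · rw [odot_comm (f p.1)⋆, ← odot_assoc, odot_star_of_le_star he (hg.apply_le _)]
    · rw [← odot_assoc, odot_star_of_le_star he' ((hf.apply_le _).trans (star_star e).ge)]
  · change f 𝟎 ∔ g 𝟎 = _
    rw [hf.map_zero, hg.map_zero, oplus_zero]

end Interval

/-! ### Finite chains in decidable form -/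

section Chain

/-- The finite MV-chain `0 < 1 < ⋯ < m`, with truncated addition. -/
instance instFin (m : ℕ) : MVAlgebra (Fin (m + 1)) where
  oplus i j := ⟨min m (i + j), by omega⟩
  star i := ⟨m - i, by omega⟩
  zero := ⟨0, by omega⟩
  oplus_assoc i j k := by ext; simp only; omega
  oplus_comm i j := by ext; simp only; omega
  oplus_zero i := by ext; simp only; omega
  star_star i := by ext; simp only; omega
  oplus_star_zero i := by ext; simp only; omega
  oplus_star_oplus i j := by ext; simp only; omega

/-- Passing to numerators makes the finite checks on `L n` decidable. -/
theorem isomorphic_L_fin (m : ℕ) : Isomorphic (L (m + 2)) (Fin (m + 2)) := by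
  have hpos : (0 : ℝ) < ((m + 1 : ℕ) : ℝ) := by positivity
  have hmem (i : Fin (m + 2)) :
      ((i : ℕ) : ℝ) / ((m + 1 : ℕ) : ℝ) ∈ unitInterval := by
    refine ⟨by positivity, (div_le_one hpos).2 ?_⟩
    exact_mod_cast Nat.lt_succ_iff.1 i.2
  refine (isomorphic_of_bijective (fun i : Fin (m + 2) =>
    (⟨⟨_, hmem i⟩, i, Nat.lt_succ_iff.1 i.2, rfl⟩ : L (m + 2))) ⟨fun i j h => ?_, ?_⟩
    (fun i j => ?_) (fun i => ?_) ?_).symm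
  · have h' := congrArg (fun x : L (m + 2) => ((x : unitInterval) : ℝ)) h
    simp only [div_left_inj' hpos.ne', Nat.cast_inj] at h'
    exact Fin.ext h'
  · rintro ⟨⟨x, hx⟩, k, hk, hxk⟩
    exact ⟨⟨k, Nat.lt_succ_iff.2 hk⟩, Subtype.ext (Subtype.ext hxk.symm)⟩
  · refine Subtype.ext (Subtype.ext ?_)
    change ((min (m + 1) ((i : ℕ) + j) : ℕ) : ℝ) / ((m + 1 : ℕ) : ℝ) =
      min 1 (((i : ℕ) : ℝ) / ((m + 1 : ℕ) : ℝ) + ((j : ℕ) : ℝ) / ((m + 1 : ℕ) : ℝ))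
    rw [Nat.cast_min, ← min_div_div_right hpos.le, div_self hpos.ne', Nat.cast_add (i : ℕ), add_div]
  · refine Subtype.ext (Subtype.ext ?_)
    change ((m + 1 - (i : ℕ) : ℕ) : ℝ) / ((m + 1 : ℕ) : ℝ) =
      1 - ((i : ℕ) : ℝ) / ((m + 1 : ℕ) : ℝ)
    rw [Nat.cast_sub (Nat.lt_succ_iff.1 i.2), sub_div, div_self hpos.ne']
  · refine Subtype.ext (Subtype.ext ?_)
    change ((0 : ℕ) : ℝ) / ((m + 1 : ℕ) : ℝ) = 0
    simp

instance : DecidableEq B4 := inferInstanceAs (DecidableEq (Bool × Bool))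

instance : Fintype B4 := inferInstanceAs (Fintype (Bool × Bool))

/-- The comparison map from the square of the two-element chain to `B4`. -/
def finTwoProdToB4 (p : Fin 2 × Fin 2) : B4 :=
  ((p.1 == 1, p.2 == 1) : Bool × Bool)

theorem isomorphic_fin_two_prod_B4 : Isomorphic (Fin 2 × Fin 2) B4 :=
  isomorphic_of_bijective finTwoProdToB4
    ⟨by unfold Function.Injective; decide, by unfold Function.Surjective; decide⟩
    (by decide) (by decide) (by decide)

end Chain

/-! ### Chains generated by one element -/

section Multiples

variable {A : Type u} [MVAlgebra A]

attribute [local instance] lattice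

/-- The multiple `a ⊕ ⋯ ⊕ a` with `n` summands. -/
def multiple (a : A) : ℕ → A
  | 0 => 𝟎
  | n + 1 => a ∔ multiple a n

theorem multiple_one (a : A) : multiple a 1 = a := oplus_zero a

theorem multiple_two (a : A) : multiple a 2 = a ∔ a := congrArg (a ∔ ·) (multiple_one a)

theorem multiple_add (a : A) (i j : ℕ) : multiple a (i + j) = multiple a i ∔ multiple a j := by
  induction i with
  | zero => rw [Nat.zero_add, multiple, zero_oplus]
  | succ i ih => rw [Nat.add_right_comm, multiple, multiple, ih, oplus_assoc]

theorem multiple_mono (a : A) : Monotone (multiple a) :=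
  monotone_nat_of_le_succ fun _ => le_oplus_left _ _

/-- From `hs`, repeated subtraction of `a` gives `e ⊙ (i a)* = (m + 1 - i) a`. So `a ≤ (i a)*` for
`i ≤ m`, and cancellation shows that the multiples up to `m + 1` are distinct. -/
theorem isIntervalEquiv_multiple {e a : A} {m : ℕ} (ha : a ≠ 𝟎) (he : e ∔ e = e)
    (hm : multiple a (m + 1) = e) (hs : e ⊙ a⋆ = multiple a m)
    (h_surj : ∀ x ≤ e, ∃ k < m + 2, multiple a k = x) :
    IsIntervalEquiv e (fun i : Fin (m + 2) => multiple a i) := by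
  have hae : a ≤ e := hm ▸ le_oplus_right _ _
  have h_large (k : ℕ) (hk : m + 1 ≤ k) : multiple a k = e := by
    induction k, hk using Nat.le_induction with
    | base => exact hm
    | succ k _ ih =>
      rw [multiple, ih]
      refine le_antisymm ?_ (le_oplus_left _ _)
      exact (oplus_le_oplus hae le_rfl).trans he.le
  have h_star (i : ℕ) (hi : i ≤ m + 1) : e ⊙ (multiple a i)⋆ = multiple a (m + 1 - i) := by
    induction i with
    | zero => rw [multiple, odot_one, Nat.sub_zero, hm]
    | succ i ih =>
      obtain ⟨k, rfl⟩ := Nat.exists_eq_add_of_le (Nat.lt_succ_iff.1 hi)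
      have h₁ : i + k + 1 - i = k + 1 := by omega
      have h₂ : i + k + 1 - (i + 1) = k := by omega
      rw [h₂, multiple, star_oplus, odot_comm a⋆, ← odot_assoc, ih (by omega), h₁, multiple,
        odot_comm]
      have h₃ : a⋆ ⊓ multiple a k = a⋆ ⊙ (a ∔ multiple a k) := by rw [inf_eq, star_star]
      rw [← h₃]
      refine inf_eq_right.2 ((multiple_mono a (Nat.le_add_left k i)).trans ?_)
      exact hs ▸ odot_le_right _ _
  have h_ne (i j : ℕ) (hij : i < j) (hj : j ≤ m + 1) : multiple a i ≠ multiple a j := by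
    intro h
    refine ha (eq_zero_of_oplus_eq_self (y := multiple a i) ?_ ?_)
    · refine le_trans ?_ (odot_le_right e _)
      rw [h_star i (by omega)]
      exact (multiple_one a).ge.trans (multiple_mono a (by omega))
    · refine le_antisymm ?_ (le_oplus_left _ _)
      exact (multiple_mono a hij).trans h.ge
  refine ⟨fun i j => ?_, fun i => ?_, rfl, fun i j h => ?_, fun x hx => ?_⟩
  · change multiple a (min (m + 1) ((i : ℕ) + j)) = _
    rw [← multiple_add]
    rcases le_total (m + 1) ((i : ℕ) + j) with h | h
    · rw [min_eq_left h, h_large _ h, hm]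
    · rw [min_eq_right h]
  · exact (h_star i (Nat.lt_succ_iff.1 i.2)).symm
  · refine Fin.ext (le_antisymm (not_lt.1 fun hlt => ?_) (not_lt.1 fun hlt => ?_))
    · exact h_ne j i hlt (Nat.lt_succ_iff.1 i.2) h.symm
    · exact h_ne i j hlt (Nat.lt_succ_iff.1 j.2) h
  · obtain ⟨k, hk, rfl⟩ := h_surj x hx
    exact ⟨⟨k, hk⟩, rfl⟩

theorem isomorphic_L_of_multiple {a : A} {m : ℕ} (ha : a ≠ 𝟎) (hs : a⋆ = multiple a m)
    (h_surj : ∀ x, ∃ k < m + 2, multiple a k = x) : Isomorphic A (L (m + 2)) := by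
  refine (isIntervalEquiv_multiple (e := 𝟏) (m := m) ha (oplus_star_zero _) ?_ ?_
    fun x _ => h_surj x).isomorphic.trans (isomorphic_L_fin m).symm
  · rw [multiple, ← hs, oplus_comm, star_oplus_self]
  · rw [one_odot, hs]

end Multiples

/-! ### Algebras without orthogonal triples -/

section Classification

variable {A : Type u} [MVAlgebra A]

attribute [local instance] lattice

/-- No three distinct nonzero elements of `A` are pairwise orthogonal. -/
def OrthogonalTripleFree (A : Type u) [MVAlgebra A] : Prop :=
  ∀ a b c : A, a ≠ 𝟎 → b ≠ 𝟎 → c ≠ 𝟎 → a ⊙ b = 𝟎 → a ⊙ c = 𝟎 → b ⊙ c = 𝟎 →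
    a = b ∨ a = c ∨ b = c

theorem OrthogonalTripleFree.eq_or_eq_or_eq (H : OrthogonalTripleFree A) {a b c : A}
    (ha : a ≠ 𝟎) (hb : b ≠ 𝟎) (hc : c ≠ 𝟎) (hab : a ≤ b⋆) (hac : a ≤ c⋆) (hbc : b ≤ c⋆) :
    a = b ∨ a = c ∨ b = c :=
  H a b c ha hb hc (odot_eq_zero_iff.2 hab) (odot_eq_zero_iff.2 hac) (odot_eq_zero_iff.2 hbc)

theorem star_eq_zero_iff {x : A} : x⋆ = 𝟎 ↔ x = 𝟏 :=
  ⟨fun h => by rw [← h, star_star], fun h => by rw [h, star_star]⟩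

theorem eq_zero_of_le_of_le_star {e a : A} (he : e ⊓ e⋆ = 𝟎) (h : a ≤ e) (h' : a ≤ e⋆) :
    a = 𝟎 :=
  le_zero_iff.1 (he ▸ le_inf h h')

/-- Negation exchanges the two halves of a chain, so only the lower half needs classifying. -/
theorem forall_eq_of_total (h_total : ∀ x y : A, x ≤ y ∨ y ≤ x) {P : A → Prop}
    (hP : ∀ x, x ≠ 𝟎 → x ≤ x⋆ → P x) (x : A) : x = 𝟎 ∨ x = 𝟏 ∨ P x ∨ P x⋆ := by
  rcases h_total x x⋆ with h | h
  · by_cases hx : x = 𝟎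
    · exact .inl hx
    · exact .inr (.inr (.inl (hP x hx h)))
  · by_cases hx : x⋆ = 𝟎
    · exact .inr (.inl (star_eq_zero_iff.1 hx))
    · exact .inr (.inr (.inr (hP _ hx (h.trans (star_star x).ge))))

/-- A chain whose only nonzero element below its negation is `a` has at most four elements. -/
theorem isomorphic_of_unique_le_star (h_total : ∀ x y : A, x ≤ y ∨ y ≤ x) {a : A} (ha : a ≠ 𝟎)
    (haa : a ≤ a⋆) (h_unique : ∀ b, b ≠ 𝟎 → b ≤ b⋆ → b = a) :
    Isomorphic A (L 3) ∨ Isomorphic A (L 4) := by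
  have h_all (x : A) : x = 𝟎 ∨ x = 𝟏 ∨ x = a ∨ x = a⋆ := by
    rcases forall_eq_of_total h_total h_unique x with h | h | h | h
    · exact .inl h
    · exact .inr (.inl h)
    · exact .inr (.inr (.inl h))
    · exact .inr (.inr (.inr (by rw [← h, star_star])))
  by_cases h_fix : a⋆ = a
  · left
    refine isomorphic_L_of_multiple (m := 1) ha (by rw [h_fix, multiple_one]) fun x => ?_
    rcases h_all x with rfl | rfl | rfl | rfl
    · exact ⟨0, by omega, rfl⟩
    · refine ⟨2, by omega, ?_⟩
      rw [multiple_two]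
      exact (congrArg (· ∔ a) h_fix.symm).trans (star_oplus_self a)
    · exact ⟨1, by omega, multiple_one _⟩
    · exact ⟨1, by omega, by rw [multiple_one, h_fix]⟩
  · right
    have h_sum : a ∔ a⋆ ⊙ a⋆ = a⋆ := oplus_odot_star_of_le haa
    -- This is the difference of `a*` and `a`; any value but `a` contradicts `h_sum`, so `a*` is
    -- twice `a`.
    have h_two : a⋆ ⊙ a⋆ = a := by
      rcases h_all (a⋆ ⊙ a⋆) with h | h | h | h
      · rw [h, oplus_zero] at h_sum
        exact absurd h_sum.symm h_fix
      · rw [h, oplus_star_zero] at h_sum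
        exact absurd (star_injective h_sum).symm ha
      · exact h
      · rw [h] at h_sum
        exact absurd (eq_zero_of_oplus_eq_self (star_star a).ge h_sum) ha
    rw [h_two] at h_sum
    refine isomorphic_L_of_multiple (m := 2) ha (by rw [multiple_two, h_sum]) fun x => ?_
    rcases h_all x with rfl | rfl | rfl | rfl
    · exact ⟨0, by omega, rfl⟩
    · refine ⟨3, by omega, ?_⟩
      rw [multiple, multiple_two, h_sum, oplus_comm, star_oplus_self]
    · exact ⟨1, by omega, multiple_one _⟩
    · exact ⟨2, by omega, by rw [multiple_two, h_sum]⟩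

/-- The triple `a, b, c` leaves only `a` and `b` in the lower half, and `a, b, b*` forces `b* = b`.
The difference of `b` and `a` must then be `a`, so `b = 2a` and `a* = 3a`. -/
theorem OrthogonalTripleFree.isomorphic_L_five (H : OrthogonalTripleFree A)
    (h_total : ∀ x y : A, x ≤ y ∨ y ≤ x) {a b : A} (ha : a ≠ 𝟎) (hb : b ≠ 𝟎) (haa : a ≤ a⋆)
    (hbb : b ≤ b⋆) (hab : a ≤ b) (h_ne : a ≠ b) : Isomorphic A (L 5) := by
  have h_orth {x y : A} (hx : x ≤ x⋆) (hy : y ≤ y⋆) : x ≤ y⋆ := by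
    rcases h_total x y with h | h
    · exact h.trans hy
    · exact le_star_comm.1 (h.trans hx)
  have h_half (c : A) (hc : c ≠ 𝟎) (hcc : c ≤ c⋆) : c = a ∨ c = b := by
    rcases H.eq_or_eq_or_eq ha hb hc (h_orth haa hbb) (h_orth haa hcc) (h_orth hbb hcc)
      with h | h | h
    · exact absurd h h_ne
    · exact .inl h.symm
    · exact .inr h.symm
  have h_fix : b⋆ = b := by
    have hb' : b⋆ ≠ 𝟎 := fun h => hb (le_zero_iff.1 (h ▸ hbb))
    rcases H.eq_or_eq_or_eq ha hb hb' (h_orth haa hbb) (hab.trans (star_star b).ge)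
      (star_star b).ge with h | h | h
    · exact absurd h h_ne
    · exact absurd (le_antisymm hab (h ▸ hbb)) h_ne
    · exact h.symm
  have h_sum : a ∔ b ⊙ a⋆ = b := oplus_odot_star_of_le hab
  have h_diff : b ⊙ a⋆ = a := by
    by_cases h₀ : b ⊙ a⋆ = 𝟎
    · rw [h₀, oplus_zero] at h_sum
      exact absurd h_sum h_ne
    · have hle : b ⊙ a⋆ ≤ b := odot_le_left _ _
      rcases h_half _ h₀ (hle.trans (le_star_comm.1 (hle.trans h_fix.ge))) with h | h
      · exact h
      · rw [h] at h_sum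
        exact absurd (eq_zero_of_oplus_eq_self (hab.trans h_fix.ge) h_sum) ha
  have h_two : multiple a 2 = b := by
    rw [multiple_two]
    rwa [h_diff] at h_sum
  have h_three : multiple a 3 = a⋆ := by
    have h := star_odot b a⋆
    rw [h_diff, h_fix, star_star, oplus_comm] at h
    rw [multiple, h_two, h]
  refine isomorphic_L_of_multiple (m := 3) ha h_three.symm fun x => ?_
  rcases forall_eq_of_total h_total h_half x with rfl | rfl | (rfl | rfl) | h | h
  · exact ⟨0, by omega, rfl⟩
  · refine ⟨4, by omega, ?_⟩
    rw [multiple, h_three, oplus_comm, star_oplus_self]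
  · exact ⟨1, by omega, multiple_one _⟩
  · exact ⟨2, by omega, h_two⟩
  · exact ⟨3, by omega, by rw [h_three, ← h, star_star]⟩
  · refine ⟨2, by omega, ?_⟩
    rw [h_two, ← star_star x, h, h_fix]

theorem OrthogonalTripleFree.isomorphic_of_total (H : OrthogonalTripleFree A)
    (h_total : ∀ x y : A, x ≤ y ∨ y ≤ x) (h_exists : ∃ x : A, x ≠ 𝟎 ∧ x ≠ 𝟏) :
    Isomorphic A (L 3) ∨ Isomorphic A (L 4) ∨ Isomorphic A (L 5) := by
  obtain ⟨a, ha, haa⟩ : ∃ a : A, a ≠ 𝟎 ∧ a ≤ a⋆ := by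
    by_contra! h
    obtain ⟨x, hx₀, hx₁⟩ := h_exists
    rcases forall_eq_of_total h_total (P := fun _ => False) h x with h | h | h | h
    · exact hx₀ h
    · exact hx₁ h
    · exact h
    · exact h
  by_cases h_unique : ∀ b, b ≠ 𝟎 → b ≤ b⋆ → b = a
  · rcases isomorphic_of_unique_le_star h_total ha haa h_unique with h | h
    · exact .inl h
    · exact .inr (.inl h)
  · push Not at h_unique
    obtain ⟨b, hb, hbb, h_ne⟩ := h_unique
    refine .inr (.inr ?_)
    rcases h_total a b with h | h
    · exact H.isomorphic_L_five h_total ha hb haa hbb h h_ne.symm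
    · exact H.isomorphic_L_five h_total hb ha hbb haa h h_ne

theorem star_eq_of_inf_eq_zero_of_oplus_eq_one {x y : A} (h : x ⊓ y = 𝟎) (h' : x ∔ y = 𝟏) :
    x⋆ = y := by
  refine le_antisymm ?_ (le_star_comm.1 (le_star_of_inf_eq_zero h))
  rwa [le_iff, star_star]

/-- The hypothesis gives `2x ⊕ y = 1`, while `2x` remains disjoint from `y`; hence `y` is the
complement of `2x`. -/
theorem exists_complemented_of_star_oplus_eq {x y : A} (hx : x ≠ 𝟎) (hy : y ≠ 𝟎)
    (h : x ⊓ y = 𝟎) (h' : (x ∔ y)⋆ = x) : ∃ e : A, e ⊓ e⋆ = 𝟎 ∧ e ≠ 𝟎 ∧ e⋆ ≠ 𝟎 := by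
  have h₁ := inf_oplus_self_eq_zero h
  have h₂ : x ∔ x ∔ y = 𝟏 := by
    have h₃ : (x ∔ y)⋆ ∔ (x ∔ y) = 𝟏 := star_oplus_self _
    rwa [h', ← oplus_assoc] at h₃
  have h₄ := star_eq_of_inf_eq_zero_of_oplus_eq_one h₁ h₂
  refine ⟨x ∔ x, by rw [h₄, h₁], fun h₀ => hx ?_, by rwa [h₄]⟩
  exact le_zero_iff.1 ((le_oplus_right x x).trans h₀.le)

/-- The candidate triple is `x, y, (x ⊕ y)*`: either the third element is 0 and `x, y` are
complementary, or it equals one of the others. -/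
theorem OrthogonalTripleFree.exists_complemented (H : OrthogonalTripleFree A) {x y : A}
    (hx : x ≠ 𝟎) (hy : y ≠ 𝟎) (h : x ⊓ y = 𝟎) : ∃ e : A, e ⊓ e⋆ = 𝟎 ∧ e ≠ 𝟎 ∧ e⋆ ≠ 𝟎 := by
  by_cases h₀ : (x ∔ y)⋆ = 𝟎
  · have h₁ := star_eq_of_inf_eq_zero_of_oplus_eq_one h (star_eq_zero_iff.1 h₀)
    exact ⟨x, by rw [h₁, h], hx, by rwa [h₁]⟩
  · rcases H.eq_or_eq_or_eq hx hy h₀ (le_star_of_inf_eq_zero h)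
      ((le_oplus_right x y).trans (star_star _).ge)
      ((le_oplus_left y x).trans (star_star _).ge) with h₁ | h₁ | h₁
    · rw [← h₁, inf_idem] at h
      exact absurd h hx
    · exact exists_complemented_of_star_oplus_eq hx hy h h₁.symm
    · exact exists_complemented_of_star_oplus_eq hy hx (inf_comm x y ▸ h)
        (oplus_comm x y ▸ h₁.symm)

/-- In the triple `a, e ⊙ a*, e*` the last element cannot equal either of the others, which are
nonzero and below `e`. -/
theorem OrthogonalTripleFree.odot_star_eq (H : OrthogonalTripleFree A) {e a : A}
    (he : e ⊓ e⋆ = 𝟎) (he' : e⋆ ≠ 𝟎) (ha : a ≠ 𝟎) (hae : a ≤ e) (h_ne : a ≠ e) :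
    e ⊙ a⋆ = a := by
  have h₀ : e ⊙ a⋆ ≠ 𝟎 := fun h => h_ne (le_antisymm hae (odot_star_eq_zero_iff.1 h))
  rcases H.eq_or_eq_or_eq ha h₀ he' (le_star_comm.1 (odot_le_right _ _))
    (hae.trans (star_star e).ge) ((odot_le_left _ _).trans (star_star e).ge) with h | h | h
  · exact h.symm
  · exact absurd (eq_zero_of_le_of_le_star he hae h.le) ha
  · exact absurd (eq_zero_of_le_of_le_star he (odot_le_left _ _) h.le) h₀

/-- With `e*` as third element, orthogonal nonzero elements below `e` coincide. If `a ⊓ b` is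
nonzero, it is orthogonal to both `a` and `b`, as each lies below its own negation. -/
theorem OrthogonalTripleFree.eq_of_lt_complemented (H : OrthogonalTripleFree A) {e a b : A}
    (he : e ⊓ e⋆ = 𝟎) (he' : e⋆ ≠ 𝟎) (ha : a ≠ 𝟎) (hae : a ≤ e) (ha_ne : a ≠ e)
    (hb : b ≠ 𝟎) (hbe : b ≤ e) (hb_ne : b ≠ e) : a = b := by
  have key {x y : A} (hx : x ≠ 𝟎) (hy : y ≠ 𝟎) (hxe : x ≤ e) (hye : y ≤ e) (hxy : x ≤ y⋆) :
      x = y := by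
    rcases H.eq_or_eq_or_eq hx hy he' hxy (hxe.trans (star_star e).ge)
      (hye.trans (star_star e).ge) with h | h | h
    · exact h
    · exact absurd (eq_zero_of_le_of_le_star he hxe h.le) hx
    · exact absurd (eq_zero_of_le_of_le_star he hye h.le) hy
  have h_half {x : A} (hx : x ≠ 𝟎) (hxe : x ≤ e) (hx_ne : x ≠ e) : x ≤ x⋆ :=
    (H.odot_star_eq he he' hx hxe hx_ne).ge.trans (odot_le_right _ _)
  by_cases h₀ : a ⊓ b = 𝟎
  · exact key ha hb hae hbe (le_star_of_inf_eq_zero h₀)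
  · have h₁ : a ⊓ b = a :=
      key h₀ ha (inf_le_left.trans hae) hae (inf_le_left.trans (h_half ha hae ha_ne))
    have h₂ : a ⊓ b = b :=
      key h₀ hb (inf_le_left.trans hae) hbe (inf_le_right.trans (h_half hb hbe hb_ne))
    rw [← h₁, h₂]

/-- The midpoint `a` is recorded in order to rule out two three-element factors. -/
theorem OrthogonalTripleFree.interval_cases (H : OrthogonalTripleFree A) {e : A}
    (he : e ⊓ e⋆ = 𝟎) (h_ne : e ≠ 𝟎) (he' : e⋆ ≠ 𝟎) :
    (∃ f : Fin 2 → A, IsIntervalEquiv e f) ∨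
      ((∃ f : Fin 3 → A, IsIntervalEquiv e f) ∧ ∃ a, a ≠ 𝟎 ∧ a ≤ e ∧ e ⊙ a⋆ = a) := by
  have hee := oplus_self_of_inf_star_eq_zero he
  by_cases h : ∃ a, a ≠ 𝟎 ∧ a ≤ e ∧ a ≠ e
  · obtain ⟨a, ha, hae, ha_ne⟩ := h
    have h_diff := H.odot_star_eq he he' ha hae ha_ne
    have h_two : multiple a 2 = e := by
      have h := oplus_odot_star_of_le hae
      rwa [h_diff, ← multiple_two] at h
    refine .inr ⟨⟨_, isIntervalEquiv_multiple (m := 1) ha hee h_two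
      (h_diff.trans (multiple_one a).symm) fun x hx => ?_⟩, a, ha, hae, h_diff⟩
    by_cases hx₀ : x = 𝟎
    · exact ⟨0, by omega, hx₀.symm⟩
    · by_cases hxe : x = e
      · exact ⟨2, by omega, h_two.trans hxe.symm⟩
      · refine ⟨1, by omega, (multiple_one a).trans ?_⟩
        exact H.eq_of_lt_complemented he he' ha hae ha_ne hx₀ hx hxe
  · push Not at h
    refine .inl ⟨_, isIntervalEquiv_multiple (m := 0) h_ne hee (multiple_one e)
      (odot_star_self e) fun x hx => ?_⟩
    by_cases hx₀ : x = 𝟎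
    · exact ⟨0, by omega, hx₀.symm⟩
    · exact ⟨1, by omega, (multiple_one e).trans (h x hx₀ hx).symm⟩

theorem OrthogonalTripleFree.isomorphic_of_complemented (H : OrthogonalTripleFree A) {e : A}
    (he : e ⊓ e⋆ = 𝟎) (h_ne : e ≠ 𝟎) (he' : e⋆ ≠ 𝟎) :
    Isomorphic A B4 ∨ Isomorphic A (L 2 × L 3) := by
  have h_star := star_inf_star_star he
  have h_prod : Isomorphic (Fin 2 × Fin 3) (L 2 × L 3) :=
    (isomorphic_L_fin 0).symm.prod (isomorphic_L_fin 1).symm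
  rcases H.interval_cases he h_ne he' with ⟨f, hf⟩ | ⟨⟨f, hf⟩, a, ha, hae, ha_diff⟩ <;>
    rcases H.interval_cases h_star he' ((star_star e).trans_ne h_ne) with
      ⟨g, hg⟩ | ⟨⟨g, hg⟩, b, hb, hbe, hb_diff⟩
  · exact .inl ((hf.isomorphic_prod he hg).trans isomorphic_fin_two_prod_B4)
  · exact .inr ((hf.isomorphic_prod he hg).trans h_prod)
  · exact .inr ((hg.isomorphic_prod h_star ((star_star e).symm ▸ hf)).trans h_prod)
  -- The midpoints give the triple `a, b, a ⊕ b`: both `a* = e* ⊕ a` and `b* = e ⊕ b` lie above `a ⊕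
  -- b`.
  · exfalso
    have ha_star : a⋆ = e⋆ ∔ a := by
      have h := congrArg star ha_diff
      rwa [star_odot, star_star, eq_comm] at h
    have hb_star : b⋆ = e ∔ b := by
      have h := congrArg star hb_diff
      rwa [star_odot, star_star, star_star, eq_comm] at h
    have h₁ : a ∔ b ≤ a⋆ := by
      rw [ha_star, oplus_comm]
      exact oplus_le_oplus hbe le_rfl
    have h₂ : a ∔ b ≤ b⋆ := by
      rw [hb_star]
      exact oplus_le_oplus hae le_rfl
    have h₃ : a ≤ b⋆ := (le_oplus_right a b).trans h₂
    have h₄ : a ∔ b ≠ 𝟎 := fun h => ha (le_zero_iff.1 ((le_oplus_right a b).trans h.le))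
    rcases H.eq_or_eq_or_eq ha hb h₄ h₃ (le_star_comm.1 h₁) (le_star_comm.1 h₂) with h | h | h
    · exact ha (eq_zero_of_le_of_le_star he hae (h.le.trans hbe))
    · exact hb (eq_zero_of_oplus_eq_self (le_star_comm.1 h₃) ((oplus_comm b a).trans h.symm))
    · exact ha (eq_zero_of_oplus_eq_self h₃ h.symm)

theorem OrthogonalTripleFree.isomorphic (H : OrthogonalTripleFree A)
    (h_exists : ∃ x : A, x ≠ 𝟎 ∧ x ≠ 𝟏) :
    Isomorphic A (L 3) ∨ Isomorphic A (L 4) ∨ Isomorphic A (L 5) ∨ Isomorphic A B4 ∨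
      Isomorphic A (L 2 × L 3) := by
  by_cases h_total : ∀ x y : A, x ≤ y ∨ y ≤ x
  · rcases H.isomorphic_of_total h_total h_exists with h | h | h
    · exact .inl h
    · exact .inr (.inl h)
    · exact .inr (.inr (.inl h))
  · push Not at h_total
    obtain ⟨x, y, hxy, hyx⟩ := h_total
    obtain ⟨e, he, h_ne, he'⟩ := H.exists_complemented
      (fun h => hxy (odot_star_eq_zero_iff.1 h)) (fun h => hyx (odot_star_eq_zero_iff.1 h))
      (odot_star_inf_odot_star x y)
    exact .inr (.inr (.inr (H.isomorphic_of_complemented he h_ne he')))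

end Classification

/-! ### Girth of the zero-divisor graph -/

section Graph

variable {A : Type u} {B : Type v} [MVAlgebra A] [MVAlgebra B]

theorem egirth_eq_three_of_not_orthogonalTripleFree (h : ¬ OrthogonalTripleFree A) :
    (zeroDivisorGraph A).egirth = 3 := by
  classical
  unfold OrthogonalTripleFree at h
  push Not at h
  obtain ⟨a, b, c, ha, hb, hc, hab, hac, hbc, h₁, h₂, h₃⟩ := h
  let x : nonzeroZeroDivisors A := ⟨a, ha, b, hb, hab⟩
  let y : nonzeroZeroDivisors A := ⟨b, hb, c, hc, hbc⟩
  let z : nonzeroZeroDivisors A := ⟨c, hc, a, ha, (odot_comm c a).trans hac⟩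
  have h_clique : (zeroDivisorGraph A).IsNClique 3 {x, y, z} :=
    SimpleGraph.is3Clique_triple_iff.2 ⟨⟨fun h => h₁ (congrArg Subtype.val h), hab⟩,
      ⟨fun h => h₂ (congrArg Subtype.val h), hac⟩, ⟨fun h => h₃ (congrArg Subtype.val h), hbc⟩⟩
  obtain ⟨_, w, hw, hlen⟩ := SimpleGraph.is3Clique_iff_exists_cycle_length_three.1 ⟨_, h_clique⟩
  refine le_antisymm ?_ SimpleGraph.three_le_egirth
  exact (SimpleGraph.egirth_le_length hw).trans (by rw [hlen]; rfl)

instance (n : ℕ) : DecidableRel (SimpleGraph.pathGraph n).Adj := fun _ _ =>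
  decidable_of_iff' _ SimpleGraph.pathGraph_adj

theorem isAcyclic_pathGraph_four : (SimpleGraph.pathGraph 4).IsAcyclic := by
  refine (SimpleGraph.isTree_iff_connected_and_card.2
    ⟨SimpleGraph.pathGraph_connected 3, ?_⟩).isAcyclic
  rw [Nat.card_eq_fintype_card, ← SimpleGraph.edgeFinset_card, Nat.card_eq_fintype_card]
  decide

/-- If the proper nonzero elements of `B` embed in the path with four vertices, then the
zero-divisor graph of every MV-algebra isomorphic to `B` is acyclic. -/
theorem egirth_eq_top_of_isomorphic (h : Isomorphic A B) (r : B → Fin 4)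
    (h_inj : ∀ x y : B, x ≠ 𝟎 → y ≠ 𝟎 → x ≠ 𝟏 → y ≠ 𝟏 → r x = r y → x = y)
    (h_adj : ∀ x y : B, x ≠ 𝟎 → y ≠ 𝟎 → x ≠ y → x ⊙ y = 𝟎 →
      (SimpleGraph.pathGraph 4).Adj (r x) (r y)) :
    (zeroDivisorGraph A).egirth = ⊤ := by
  obtain ⟨f⟩ := h
  have hf_odot (x y : A) : f.toFun (x ⊙ y) = f.toFun x ⊙ f.toFun y := by
    simp only [odot, f.map_star, f.map_oplus]
  have hf_ne {x : A} (hx : x ≠ 𝟎) : f.toFun x ≠ 𝟎 := fun h =>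
    hx (f.toEquiv.injective (h.trans f.map_zero.symm))
  have hf_ne_one (x : nonzeroZeroDivisors A) : f.toFun x ≠ 𝟏 := by
    obtain ⟨x, hx, y, hy, hxy⟩ := x
    intro h
    have h' := hf_odot x y
    rw [hxy, f.map_zero, h, one_odot] at h'
    exact hf_ne hy h'.symm
  rw [SimpleGraph.egirth_eq_top]
  let g : zeroDivisorGraph A →g SimpleGraph.pathGraph 4 :=
    { toFun := fun x => r (f.toFun x)
      map_rel' := fun {x y} hxy => by
        refine h_adj _ _ (hf_ne x.2.1) (hf_ne y.2.1) ?_ ?_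
        · exact fun h => hxy.1 (Subtype.ext (f.toEquiv.injective h))
        · rw [← hf_odot, hxy.2, f.map_zero] }
  refine isAcyclic_pathGraph_four.comap g fun x y hxy => ?_
  exact Subtype.ext (f.toEquiv.injective
    (h_inj _ _ (hf_ne x.2.1) (hf_ne y.2.1) (hf_ne_one x) (hf_ne_one y) hxy))

/-- Here and below, table entries are positions on the path; those at 0 and 1, which are not
vertices, are fillers. -/
theorem egirth_eq_top_of_isomorphic_L_three (h : Isomorphic A (L 3)) :
    (zeroDivisorGraph A).egirth = ⊤ :=
  egirth_eq_top_of_isomorphic (h.trans (isomorphic_L_fin 1)) ![0, 0, 0]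
    (by decide) (by decide)

theorem egirth_eq_top_of_isomorphic_L_four (h : Isomorphic A (L 4)) :
    (zeroDivisorGraph A).egirth = ⊤ :=
  egirth_eq_top_of_isomorphic (h.trans (isomorphic_L_fin 2)) ![0, 0, 1, 0]
    (by decide) (by decide)

theorem egirth_eq_top_of_isomorphic_L_five (h : Isomorphic A (L 5)) :
    (zeroDivisorGraph A).egirth = ⊤ :=
  egirth_eq_top_of_isomorphic (h.trans (isomorphic_L_fin 3)) ![0, 1, 0, 2, 0]
    (by decide) (by decide)

theorem egirth_eq_top_of_isomorphic_B4 (h : Isomorphic A B4) :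
    (zeroDivisorGraph A).egirth = ⊤ :=
  egirth_eq_top_of_isomorphic (h.trans isomorphic_fin_two_prod_B4.symm)
    (fun p => ![![0, 0], ![1, 0]] p.1 p.2) (by decide) (by decide)

theorem egirth_eq_top_of_isomorphic_L_two_prod_L_three (h : Isomorphic A (L 2 × L 3)) :
    (zeroDivisorGraph A).egirth = ⊤ :=
  egirth_eq_top_of_isomorphic (B := Fin 2 × Fin 3)
    (h.trans ((isomorphic_L_fin 0).prod (isomorphic_L_fin 1)))
    (fun p => ![![0, 1, 3], ![2, 0, 0]] p.1 p.2) (by decide) (by decide)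

end Graph

end MVAlgebra

theorem theorem4p4 {A : Type*} [MVAlgebra A] (hA : 3 ≤ Cardinal.mk A) :
    ((MVAlgebra.Isomorphic A (MVAlgebra.L 3) ∨ MVAlgebra.Isomorphic A (MVAlgebra.L 4) ∨
        MVAlgebra.Isomorphic A (MVAlgebra.L 5) ∨ MVAlgebra.Isomorphic A MVAlgebra.B4 ∨
        MVAlgebra.Isomorphic A (MVAlgebra.L 2 × MVAlgebra.L 3)) →
      (MVAlgebra.zeroDivisorGraph A).egirth = ⊤) ∧
    (¬ (MVAlgebra.Isomorphic A (MVAlgebra.L 3) ∨ MVAlgebra.Isomorphic A (MVAlgebra.L 4) ∨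
        MVAlgebra.Isomorphic A (MVAlgebra.L 5) ∨ MVAlgebra.Isomorphic A MVAlgebra.B4 ∨
        MVAlgebra.Isomorphic A (MVAlgebra.L 2 × MVAlgebra.L 3)) →
      (MVAlgebra.zeroDivisorGraph A).egirth = 3) := by
  refine ⟨?_, fun h => ?_⟩
  · rintro (h | h | h | h | h)
    · exact MVAlgebra.egirth_eq_top_of_isomorphic_L_three h
    · exact MVAlgebra.egirth_eq_top_of_isomorphic_L_four h
    · exact MVAlgebra.egirth_eq_top_of_isomorphic_L_five h
    · exact MVAlgebra.egirth_eq_top_of_isomorphic_B4 h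
    · exact MVAlgebra.egirth_eq_top_of_isomorphic_L_two_prod_L_three h
  · obtain ⟨x, hx⟩ := Cardinal.exists_ne_ne_of_three_le hA MVAlgebra.zero (MVAlgebra.star MVAlgebra.zero)
    exact MVAlgebra.egirth_eq_three_of_not_orthogonalTripleFree fun H => h (H.isomorphic ⟨x, hx⟩)
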